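/- Let $m\ge 0$ parties be given, the $i$-th with Hilbert space $\mathcal H^{(i)}=\mathbb C^{d_i}$, $d_i\ge 1$, and let $r\ge 1$. A \emph{block of rank-$r$ projectors} on a finite-dimensional Hilbert space is a finite, possibly empty, sequence $\mathbb P=(P_0,\dots,P_{\ell-1})$ of orthogonal projectors of rank exactly $r$ such that the distinct projectors occurring in it are linearly independent and the sequence is \emph{simplified}: $P_jP_{j+1}\ne 0$ and $P_j\neq P_{j+1}$ for adjacent members. Write $\hat{\mathbb P}=P_0P_1\cdots P_{\ell-1}$ (the identity if $\ell=0$), and let $\|\mathbb P\|=0$ if $\hat{\mathbb P}=\mathbb 1$ and $\|\mathbb P\|=\ell$ otherwise. For every party $i$ let $\mathbb P^{(i)}$ and $\mathbb P'^{(i)}$ be two blocks of rank-$r$ projectors on $\mathcal H^{(i)}$. For a state $\rho$ put $e_1=\operatorname{Tr}(\rho\,\hat{\mathbb P}^{(0)}\otimes\dots\otimes\hat{\mathbb P}^{(m-1)})$ and $e_2=\operatorname{Tr}(\rho\,\hat{\mathbb P}'^{(0)}\otimes\dots\otimes\hat{\mathbb P}'^{(m-1)})$. Say that $e_1$ and $e_2$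 are \emph{algebraically equal} if the two operator products $\prod_i\prod_j P^{(i)}_j$ and $\prod_i\prod_j P'^{(i)}_j$, read as formal words in symbols $[X]_i$ for operators $X$ on $\mathcal H^{(i)}$, coincide in the complex unital algebra generated by these symbols modulo the algebraic properties of projectors: $[X]_i^2=[X]_i$ for projectors $X$; $[X]_i[Y]_i=0$ for projectors with $XY=0$; $[X]_i[Y]_j=[Y]_j[X]_i$ for projectors $X,Y$ of different parties $i\ne j$; and $[\mathbb 1]_i=1$. A \emph{rank-$s$ realisation} of the given blocks replaces, for each party $i$, the projectors occurring in $\mathbb P^{(i)}$ or $\mathbb P'^{(i)}$ by rank-$s$ projectors on some space $\mathbb C^{n_i}$ such that distinct projectors go to distinct ones, two projectors are orthogonal if and only if their replacements are, a projector is the identity if and only if its replacement is, and the two sequences of replacements are again blocks of rank-$s$ projectors. Say that $e_1=e_2$ \emph{identically at rank $s$} if $e_1=e_2$ holds for all rank-$s$ realisations and all states $\rho$ on $\bigotimes_i\mathbb C^{n_i}$. Let (B) be the condition $$\|\mathbb P^{(i)}\|=\|\mathbb P'^{(i)}\|\quad\text{and}\quad P^{(i)}_j=P'^{(i)}_j\qquad\text{for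 all } i\in\{0,\dots,m-1\}\text{ and all } 0\le j<\|\mathbb P^{(i)}\|.$$ Then: 1. $e_1$ and $e_2$ are algebraically equal if and only if (B) holds; 2. $e_1=e_2$ holds identically at every rank $s\ge 1$ if and only if (B) holds; 3. if $r\ge 2$, then $e_1=e_2$ holds identically at rank $r$ if and only if (B) holds. -/

import Mathlib

open scoped Matrix ComplexOrder

noncomputable section

namespace MomentEntry

/-- Operators on the finite-dimensional Hilbert space `ℂ ^ d`. -/
abbrev Op (d : ℕ) : Type := Matrix (Fin d) (Fin d) ℂ

/-- Operators on `ℂ ^ d 0 ⊗ ⋯ ⊗ ℂ ^ d (m - 1)`, written in the product basis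
`e_(x 0) ⊗ ⋯ ⊗ e_(x (m - 1))`. -/
abbrev JointOp {m : ℕ} (d : Fin m → ℕ) : Type :=
  Matrix (∀ i, Fin (d i)) (∀ i, Fin (d i)) ℂ

/-- The tensor product `A 0 ⊗ ⋯ ⊗ A (m - 1)` in the product basis. -/
def tensorOp {m : ℕ} {d : Fin m → ℕ} (A : ∀ i, Op (d i)) : JointOp d :=
  Matrix.of fun x y => ∏ i, A i (x i) (y i)

/-- Quantum states (density matrices) on the joint system. -/
def IsState {m : ℕ} {d : Fin m → ℕ} (ρ : JointOp d) : Prop :=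
  ρ.PosSemidef ∧ ρ.trace = 1

/-- The operator `P_0 P_1 ⋯ P_(n - 1)` of a sequence of projectors;
it is the identity for the empty sequence. -/
def blockOp {d : ℕ} (P : List (Op d)) : Op d := P.prod

/-- The moment matrix entry `Tr (ρ (P̂ 0 ⊗ ⋯ ⊗ P̂ (m - 1)))`. -/
def momentEntry {m : ℕ} {d : Fin m → ℕ} (ρ : JointOp d) (P : ∀ i, List (Op (d i))) : ℂ :=
  (ρ * tensorOp fun i => blockOp (P i)).trace

/-- A sequence is simplified if any two adjacent members are non-orthogonal and distinct. -/
def IsSimplified {d : ℕ} (P : List (Op d)) : Prop :=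
  P.IsChain fun X Y => X * Y ≠ 0 ∧ X ≠ Y

/-- A simplified block of rank-`r` projectors: a simplified finite sequence of orthogonal
projectors of rank exactly `r`, the distinct ones among them being linearly independent. -/
structure IsBlock {d : ℕ} (r : ℕ) (P : List (Op d)) : Prop where
  projector : ∀ X ∈ P, IsStarProjection X
  rank_eq : ∀ X ∈ P, X.rank = r
  independent : LinearIndepOn ℂ id {X : Op d | X ∈ P}
  simplified : IsSimplified P

open Classical in
/-- The norm (length) of a block: `0` if the block acts as the identity,
the number of projectors in it otherwise. -/
def blockNorm {d : ℕ} (P : List (Op d)) : ℕ :=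
  if blockOp P = 1 then 0 else P.length

/-- Every party's two blocks have the same norm and agree projector by projector. -/
def BlocksAgree {m : ℕ} {d : Fin m → ℕ} (P P' : ∀ i, List (Op (d i))) : Prop :=
  ∀ i, blockNorm (P i) = blockNorm (P' i) ∧
    ∀ j < blockNorm (P i), (P i)[j]? = (P' i)[j]?

/-- The free algebra with one symbol for each operator of each party. -/
abbrev FormalAlg {m : ℕ} (d : Fin m → ℕ) : Type :=
  FreeAlgebra ℂ (Σ i, Op (d i))

/-- The symbol of the operator `X` of party `i`. -/
def sym {m : ℕ} {d : Fin m → ℕ} (i : Fin m) (X : Op (d i)) : FormalAlg d :=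
  FreeAlgebra.ι ℂ (⟨i, X⟩ : Σ i, Op (d i))

/-- The algebraic properties of projectors: a projector is idempotent, orthogonal projectors of
one party multiply to zero, projectors of different parties commute, and the projector onto the
whole space of a party is the unit. -/
inductive ProjRel {m : ℕ} (d : Fin m → ℕ) : FormalAlg d → FormalAlg d → Prop
  | idempotent (i : Fin m) (X : Op (d i)) (hX : IsStarProjection X) :
      ProjRel d (sym i X * sym i X) (sym i X)
  | orthogonal (i : Fin m) (X Y : Op (d i)) (hX : IsStarProjection X) (hY : IsStarProjection Y)
      (hXY : X * Y = 0) : ProjRel d (sym i X * sym i Y) 0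
  | commute (i j : Fin m) (hij : i ≠ j) (X : Op (d i)) (Y : Op (d j))
      (hX : IsStarProjection X) (hY : IsStarProjection Y) :
      ProjRel d (sym i X * sym j Y) (sym j Y * sym i X)
  | unit (i : Fin m) : ProjRel d (sym i 1) 1

/-- The formal operator of a family of blocks: the product of the symbols of its projectors,
party after party. -/
def formalOp {m : ℕ} {d : Fin m → ℕ} (P : ∀ i, List (Op (d i))) : FormalAlg d :=
  (List.ofFn fun i => ((P i).map (sym i)).prod).prod

/-- The two operators inside the moment entries are equal by the algebraic properties
of projectors alone. -/
def AlgebraicallyEqual {m : ℕ} {d : Fin m → ℕ} (P P' : ∀ i, List (Op (d i))) : Prop :=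
  RingQuot.mkAlgHom ℂ (ProjRel d) (formalOp P) = RingQuot.mkAlgHom ℂ (ProjRel d) (formalOp P')

/-- `φ` replaces the projectors occurring in the blocks `P i` and `P' i` by rank-`s` projectors on
`ℂ ^ n i` such that one again has blocks of projectors, with the same coincidences and the
same orthogonality relations (and the full projector stays the full projector). -/
structure IsRealisation {m : ℕ} {d : Fin m → ℕ} (P P' : ∀ i, List (Op (d i)))
    (s : ℕ) (n : Fin m → ℕ) (φ : ∀ i, Op (d i) → Op (n i)) : Prop where
  block : ∀ i, IsBlock s ((P i).map (φ i))
  block' : ∀ i, IsBlock s ((P' i).map (φ i))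
  coincidence : ∀ i, ∀ X ∈ P i ++ P' i, ∀ Y ∈ P i ++ P' i, (φ i X = φ i Y ↔ X = Y)
  orthogonality : ∀ i, ∀ X ∈ P i ++ P' i, ∀ Y ∈ P i ++ P' i, (φ i X * φ i Y = 0 ↔ X * Y = 0)
  unit : ∀ i, ∀ X ∈ P i ++ P' i, (φ i X = 1 ↔ X = 1)

/-- The two moment entries coincide for every state and every realisation of the blocks by
rank-`s` projectors on finite-dimensional Hilbert spaces. -/
def EntriesEqualAtRank {m : ℕ} {d : Fin m → ℕ} (s : ℕ) (P P' : ∀ i, List (Op (d i))) : Prop :=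
  ∀ (n : Fin m → ℕ) (φ : ∀ i, Op (d i) → Op (n i)), IsRealisation P P' s n φ →
    ∀ ρ : JointOp n, IsState ρ →
      momentEntry ρ (fun i => (P i).map (φ i)) = momentEntry ρ (fun i => (P' i).map (φ i))

end MomentEntry

end

/-! The three conditions are linked by the cycle (B) ⇒ algebraic equality ⇒ equality of entries at
every rank ⇒ (B), where the last arrow needs only one rank `s ≥ 2`. For the first arrow, a block
acting as the identity consists of identities only, so its word reduces to `1`; blocks of nonzero
norm that agree are the same list. For the second, every realisation extends to a representation of
the formal algebra (`realisationHom_rel`).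

For the third, states separate operators and equal nonzero tensor products have proportional
factors, so it suffices to find, for each party, a realisation in which different blocks give
non-proportional operators. Let `G` be the graph of distinct non-orthogonal projectors; simplified
blocks are walks in `G`. Take `Q a = B * E a * Bᴴ`, where `E a` are coordinate projections onto
blocks of size `s` and `Bᴴ * B = 1 + ε • H`, with `H` supported on the edges. A product of `Q`'s
along a walk then contains the product of the blocks of `H` on its edges. With the blocks `!![1, a;
b, a * b + 1]`, applied to `(1, 1)`, the ratio of the resulting coordinates returns the walk by the
Euclidean algorithm (`eq_of_walkVec_proportional`). This uses two dimensions per vertex, hence `s ≥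
2`. At rank one, `P₀P₁P₀P₂P₀ = P₀P₂P₀P₁P₀` always holds. -/

namespace MomentEntry

/-! ### Elementary tensors of operators. -/

section TensorOp

variable {m : ℕ} {d : Fin m → ℕ}

theorem tensorOp_one : tensorOp (1 : ∀ i, Op (d i)) = 1 := by
  ext x y
  simp only [tensorOp, Matrix.of_apply, Pi.one_apply, Matrix.one_apply]
  by_cases h : x = y
  · simp [h]
  · obtain ⟨i, hi⟩ := Function.ne_iff.mp h
    rw [if_neg h]
    exact Finset.prod_eq_zero (Finset.mem_univ i) (if_neg hi)

theorem tensorOp_mul (A B : ∀ i, Op (d i)) :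
    tensorOp (A * B) = tensorOp A * tensorOp B := by
  ext x y
  simp only [tensorOp, Matrix.of_apply, Pi.mul_apply, Matrix.mul_apply,
    ← Finset.prod_mul_distrib]
  exact Fintype.prod_sum fun i z => A i (x i) z * B i z (y i)

/-- The tensor product of operators as a monoid homomorphism. -/
noncomputable def tensorHom (d : Fin m → ℕ) : (∀ i, Op (d i)) →* JointOp d where
  toFun := tensorOp
  map_one' := tensorOp_one
  map_mul' := tensorOp_mul

theorem tensorOp_eq_zero {A : ∀ i, Op (d i)} (i : Fin m) (h : A i = 0) : tensorOp A = 0 := by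
  ext x y
  exact Finset.prod_eq_zero (Finset.mem_univ i) (by simp [h])

/-- Equal nonzero elementary tensors have proportional factors. -/
theorem exists_smul_eq_of_tensorOp_eq {A B : ∀ i, Op (d i)} (hA : ∀ i, A i ≠ 0)
    (h : tensorOp A = tensorOp B) (i : Fin m) :
    ∃ c : ℂ, c ≠ 0 ∧ A i = c • B i := by
  have key : ∀ A : ∀ i, Op (d i), (∀ i, A i ≠ 0) → ∃ x y : ∀ i, Fin (d i),
      ∀ j, A j (x j) (y j) ≠ 0 := by
    intro A hA
    have : ∀ j, ∃ x y, A j x y ≠ 0 := by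
      intro j
      by_contra! hj
      exact hA j (Matrix.ext hj)
    choose x y hxy using this
    exact ⟨x, y, hxy⟩
  obtain ⟨x, y, hxy⟩ := key A hA
  -- All coordinates except the `i`-th are frozen at a nonzero entry of `A`, so that only the `i`-th
  -- factor varies.
  have hent : ∀ u v, A i u v * ∏ j ∈ Finset.univ.erase i, A j (x j) (y j) =
      B i u v * ∏ j ∈ Finset.univ.erase i, B j (x j) (y j) := by
    intro u v
    have := congrFun (congrFun h (Function.update x i u)) (Function.update y i v)
    simp only [tensorOp, Matrix.of_apply] at this
    rw [← Finset.mul_prod_erase _ _ (Finset.mem_univ i),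
      ← Finset.mul_prod_erase _ _ (Finset.mem_univ i)] at this
    simp only [Function.update_self] at this
    convert this using 2 <;>
    · refine Finset.prod_congr rfl fun j hj => ?_
      rw [Function.update_of_ne (Finset.ne_of_mem_erase hj),
        Function.update_of_ne (Finset.ne_of_mem_erase hj)]
  set a := ∏ j ∈ Finset.univ.erase i, A j (x j) (y j)
  set b := ∏ j ∈ Finset.univ.erase i, B j (x j) (y j)
  have ha : a ≠ 0 := Finset.prod_ne_zero_iff.mpr fun j _ => hxy j
  have hb : b ≠ 0 := by
    intro hb
    have := hent (x i) (y i)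
    rw [hb, mul_zero] at this
    exact mul_ne_zero (hxy i) ha this
  refine ⟨b / a, div_ne_zero hb ha, ?_⟩
  ext u v
  rw [Matrix.smul_apply, smul_eq_mul, div_mul_eq_mul_div, eq_div_iff ha, hent u v, mul_comm]

end TensorOp

/-! ### States separate operators. -/

section States

/-- A matrix whose quadratic form vanishes is zero. -/
theorem eq_zero_of_quadraticForm_eq_zero {ι : Type*} [Fintype ι] [DecidableEq ι]
    {D : Matrix ι ι ℂ} (h : ∀ v : ι → ℂ, star v ⬝ᵥ (D *ᵥ v) = 0) : D = 0 := by
  have h0 : Matrix.toEuclideanLin D = 0 := by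
    rw [← inner_map_self_eq_zero]
    intro v
    have := congrArg star (h (WithLp.ofLp v))
    rw [← inner_conj_symm]
    rw [EuclideanSpace.inner_eq_star_dotProduct, dotProduct_comm]
    simpa using this
  exact (LinearEquiv.map_eq_zero_iff _).mp h0

/-- States separate operators. -/
theorem eq_of_forall_state {m : ℕ} {d : Fin m → ℕ} {S T : JointOp d}
    (h : ∀ ρ : JointOp d, IsState ρ → (ρ * S).trace = (ρ * T).trace) : S = T := by
  rw [← sub_eq_zero]
  refine eq_zero_of_quadraticForm_eq_zero fun v => ?_
  by_cases hv : v = 0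
  · simp [hv]
  set t : ℂ := star v ⬝ᵥ v with ht
  have ht0 : 0 < t := Matrix.dotProduct_star_self_pos_iff.mpr hv
  -- The pure state along `v`, whose expectation values are the quadratic form at `v` up to the
  -- factor `t⁻¹`.
  have hst : IsState (d := d) (t⁻¹ • Matrix.vecMulVec v (star v)) := by
    refine ⟨(Matrix.posSemidef_vecMulVec_self_star v).smul (by positivity), ?_⟩
    rw [Matrix.trace_smul, Matrix.trace_vecMulVec, dotProduct_comm, smul_eq_mul]
    exact inv_mul_cancel₀ ht0.ne'
  have := h _ hst
  simp only [Matrix.smul_mul, Matrix.trace_smul, smul_eq_mul] at this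
  have := mul_left_cancel₀ (inv_ne_zero ht0.ne') this
  rw [← sub_eq_zero, ← Matrix.trace_sub, ← mul_sub, Matrix.vecMulVec_mul,
    Matrix.trace_vecMulVec] at this
  rw [Matrix.dotProduct_mulVec, dotProduct_comm]
  exact this

end States

/-! ### Ordered products and products of projectors. -/

section Products

theorem prod_ofFn_eq_single {M : Type*} [Monoid M] {m : ℕ} (g : Fin m → M) (i : Fin m)
    (h : ∀ j, j ≠ i → g j = 1) : (List.ofFn g).prod = g i := by
  induction m with
  | zero => exact i.elim0
  | succ m ih =>
    rw [List.ofFn_succ, List.prod_cons]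
    refine Fin.cases (fun h => ?_) (fun i h => ?_) i h
    · have : (fun j : Fin m => g j.succ) = fun _ => 1 :=
        funext fun j => h _ (Fin.succ_ne_zero j)
      rw [this]
      simp
    · rw [ih (fun j => g j.succ) i fun j hj => h _ (by simpa using hj),
        h 0 (Fin.succ_ne_zero i).symm, one_mul]

theorem prod_ofFn_mulSingle {m : ℕ} {M : Fin m → Type*} [∀ i, Monoid (M i)] (A : ∀ i, M i) :
    (List.ofFn fun i => Pi.mulSingle i (A i)).prod = A := by
  funext i
  have h := map_list_prod (Pi.evalMonoidHom M i) (List.ofFn fun i => Pi.mulSingle i (A i))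
  rw [Pi.evalMonoidHom_apply, List.map_ofFn] at h
  rw [h, prod_ofFn_eq_single _ i]
  · simp
  · intro j hj
    simp [Pi.mulSingle_eq_of_ne hj.symm]

/-- If `X * R = 1` with `X` idempotent, then `X = X * (X * R) = X * R = 1`; induct on the rest. -/
theorem forall_eq_one_of_prod_eq_one {d : ℕ} {P : List (Op d)}
    (hP : ∀ X ∈ P, IsStarProjection X) (h : P.prod = 1) : ∀ X ∈ P, X = 1 := by
  induction P with
  | nil => simp
  | cons X P ih =>
    rw [List.prod_cons] at h
    have hX : X = 1 := by
      have hXX : X * X = X := (hP X (by simp)).isIdempotentElem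
      rw [← h, ← hXX, mul_assoc, h, hXX, mul_one]
    rw [hX, one_mul] at h
    intro Y hY
    rcases List.mem_cons.mp hY with rfl | hY
    · exact hX
    · exact ih (fun Z hZ => hP Z (by simp [hZ])) h Y hY

end Products

/-! ### The formal algebra and its representations by realisations. -/

section Algebraic

variable {m : ℕ} {d : Fin m → ℕ}

theorem mkAlgHom_formalOp (P : ∀ i, List (Op (d i))) :
    RingQuot.mkAlgHom ℂ (ProjRel d) (formalOp P) =
      (List.ofFn fun i => RingQuot.mkAlgHom ℂ (ProjRel d) ((P i).map (sym i)).prod).prod := by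
  rw [formalOp, map_list_prod, List.map_ofFn]
  rfl

theorem mkAlgHom_prod_eq_one (i : Fin m) {P : List (Op (d i))} (h : ∀ X ∈ P, X = 1) :
    RingQuot.mkAlgHom ℂ (ProjRel d) (P.map (sym i)).prod = 1 := by
  rw [map_list_prod]
  refine List.prod_eq_one fun x hx => ?_
  simp only [List.mem_map] at hx
  obtain ⟨_, ⟨X, hX, rfl⟩, rfl⟩ := hx
  rw [h X hX, RingQuot.mkAlgHom_rel ℂ (ProjRel.unit i), map_one]

theorem AlgebraicallyEqual.of_blocksAgree {P P' : ∀ i, List (Op (d i))}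
    (hP : ∀ i, ∀ X ∈ P i, IsStarProjection X) (hP' : ∀ i, ∀ X ∈ P' i, IsStarProjection X)
    (h : BlocksAgree P P') : AlgebraicallyEqual P P' := by
  rw [AlgebraicallyEqual, mkAlgHom_formalOp, mkAlgHom_formalOp]
  congr 2
  funext i
  have hzero : ∀ {Q : List (Op (d i))}, (∀ X ∈ Q, IsStarProjection X) → blockNorm Q = 0 →
      RingQuot.mkAlgHom ℂ (ProjRel d) (Q.map (sym i)).prod = 1 := by
    intro Q hQ h0
    refine mkAlgHom_prod_eq_one i ?_
    by_cases h1 : blockOp Q = 1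
    · exact forall_eq_one_of_prod_eq_one hQ h1
    · rw [blockNorm, if_neg h1, List.length_eq_zero_iff] at h0
      simp [h0]
  -- A nonzero norm is the full length, so agreement below it is equality of lists.
  have hlen : ∀ {Q : List (Op (d i))}, blockNorm Q ≠ 0 → blockNorm Q = Q.length := by
    intro Q hQ
    unfold blockNorm at hQ ⊢
    split_ifs at hQ ⊢ <;> simp_all
  obtain ⟨hn, hj⟩ := h i
  by_cases h0 : blockNorm (P i) = 0
  · rw [hzero (hP i) h0, hzero (hP' i) (hn ▸ h0)]
  · have e : P i = P' i := by
      have e1 := hlen h0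
      have e2 := hlen (hn ▸ h0)
      refine List.ext_getElem? fun j => ?_
      by_cases hlt : j < blockNorm (P i)
      · exact hj j hlt
      · rw [List.getElem?_eq_none (by omega), List.getElem?_eq_none (by omega)]
    rw [e]

open Classical in
/-- A realisation represents the algebra of formal projectors: symbols of projectors outside the
blocks, other than the unit, are sent to zero. -/
noncomputable def realisationHom {n : Fin m → ℕ} (P P' : ∀ i, List (Op (d i)))
    (φ : ∀ i, Op (d i) → Op (n i)) : FormalAlg d →ₐ[ℂ] JointOp n :=
  FreeAlgebra.lift ℂ fun x => tensorHom n (MonoidHom.mulSingle (fun i => Op (n i)) x.1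
    (if x.2 ∈ P x.1 ++ P' x.1 then φ x.1 x.2 else if x.2 = 1 then 1 else 0))

theorem realisationHom_sym {n : Fin m → ℕ} (P P' : ∀ i, List (Op (d i)))
    (φ : ∀ i, Op (d i) → Op (n i)) (i : Fin m) (X : Op (d i)) [Decidable (X ∈ P i ++ P' i)]
    [Decidable (X = 1)] :
    realisationHom P P' φ (sym i X) = tensorHom n (MonoidHom.mulSingle (fun i => Op (n i)) i
      (if X ∈ P i ++ P' i then φ i X else if X = 1 then 1 else 0)) := by
  rw [realisationHom, sym, FreeAlgebra.lift_ι_apply]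
  congr!

theorem realisationHom_formalOp {n : Fin m → ℕ} {P P' : ∀ i, List (Op (d i))}
    {φ : ∀ i, Op (d i) → Op (n i)} {Q : ∀ i, List (Op (d i))}
    (hQ : ∀ i, ∀ X ∈ Q i, X ∈ P i ++ P' i) :
    realisationHom P P' φ (formalOp Q) = tensorOp fun i => blockOp ((Q i).map (φ i)) := by
  classical
  have hparty : ∀ i, realisationHom P P' φ ((Q i).map (sym i)).prod =
      tensorHom n (MonoidHom.mulSingle (fun i => Op (n i)) i ((Q i).map (φ i)).prod) := by
    intro i
    rw [map_list_prod, map_list_prod, map_list_prod, List.map_map, List.map_map, List.map_map]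
    congr 1
    refine List.map_congr_left fun X hX => ?_
    simp only [Function.comp_apply]
    rw [realisationHom_sym, if_pos (hQ i X hX)]
  rw [formalOp, map_list_prod, List.map_ofFn]
  have : (realisationHom P P' φ ∘ fun i => ((Q i).map (sym i)).prod) =
      tensorHom n ∘ fun i => Pi.mulSingle i ((Q i).map (φ i)).prod := funext hparty
  rw [this, ← List.map_ofFn, ← map_list_prod, prod_ofFn_mulSingle]
  rfl

/-- Sending outside projectors to zero is compatible with orthogonality because the only other
exceptional symbol is the unit, and nothing nonzero is orthogonal to the identity. -/
theorem realisationHom_rel (hd : ∀ i, 0 < d i) {s : ℕ} {n : Fin m → ℕ}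
    {P P' : ∀ i, List (Op (d i))} {φ : ∀ i, Op (d i) → Op (n i)}
    (hP : ∀ i, ∀ X ∈ P i ++ P' i, X ≠ 0)
    (h : IsRealisation P P' s n φ) {a b : FormalAlg d} (hab : ProjRel d a b) :
    realisationHom P P' φ a = realisationHom P P' φ b := by
  classical
  have hproj : ∀ i, ∀ X ∈ P i ++ P' i, IsStarProjection (φ i X) := by
    intro i X hX
    rcases List.mem_append.mp hX with hX | hX
    · exact (h.block i).projector _ (List.mem_map_of_mem hX)
    · exact (h.block' i).projector _ (List.mem_map_of_mem hX)
  have hone : ∀ i, (1 : Op (d i)) ≠ 0 := by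
    intro i
    have : NeZero (d i) := ⟨(hd i).ne'⟩
    exact one_ne_zero
  have hzero : ∀ i, tensorHom n (MonoidHom.mulSingle (fun i => Op (n i)) i 0) = 0 :=
    fun i => tensorOp_eq_zero i (by simp)
  cases hab with
  | idempotent i X hX =>
    rw [map_mul, realisationHom_sym, ← map_mul, ← map_mul]
    congr 2
    split_ifs with h1 h2
    · exact (hproj i X h1).isIdempotentElem
    · simp
    · simp
  | orthogonal i X Y hX hY hXY =>
    rw [map_mul, realisationHom_sym, realisationHom_sym, ← map_mul, ← map_mul, map_zero,
      ← hzero i]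
    congr 2
    have hX1 : ¬ (X = 1 ∧ Y ∈ P i ++ P' i) := by
      rintro ⟨rfl, hY⟩
      exact hP i Y hY (by simpa using hXY)
    have hY1 : ¬ (Y = 1 ∧ X ∈ P i ++ P' i) := by
      rintro ⟨rfl, hX⟩
      exact hP i X hX (by simpa using hXY)
    have hXY1 : ¬ (X = 1 ∧ Y = 1) := by
      rintro ⟨rfl, rfl⟩
      exact hone i (by simpa using hXY)
    split_ifs with h1 h2 h3 h4 h5 h6 h7
    · exact (h.orthogonality i X h1 Y h2).mpr hXY
    all_goals first | simp; done | tauto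
  | commute i j hij X Y hX hY =>
    rw [map_mul, map_mul, realisationHom_sym, realisationHom_sym, ← map_mul, ← map_mul]
    congr 1
    exact Pi.mulSingle_commute hij _ _
  | unit i =>
    rw [realisationHom_sym, map_one]
    have : (if (1 : Op (d i)) ∈ P i ++ P' i then φ i 1 else if (1 : Op (d i)) = 1 then 1 else 0)
        = 1 := by
      split_ifs with h1 h2
      · exact (h.unit i 1 h1).mpr rfl
      · rfl
      · exact absurd rfl h2
    rw [this, map_one, map_one]

theorem AlgebraicallyEqual.entriesEqualAtRank (hd : ∀ i, 0 < d i) {s : ℕ}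
    {P P' : ∀ i, List (Op (d i))} (hP : ∀ i, ∀ X ∈ P i ++ P' i, X ≠ 0)
    (h : AlgebraicallyEqual P P') : EntriesEqualAtRank s P P' := by
  intro n φ hφ ρ _
  have hrel : ∀ ⦃a b⦄, ProjRel d a b → realisationHom P P' φ a = realisationHom P P' φ b :=
    fun _ _ hab => realisationHom_rel hd hP hφ hab
  have := congrArg (RingQuot.liftAlgHom ℂ ⟨realisationHom P P' φ, hrel⟩) h
  rw [RingQuot.liftAlgHom_mkAlgHom_apply, RingQuot.liftAlgHom_mkAlgHom_apply,
    realisationHom_formalOp (fun i X hX => List.mem_append_left _ hX),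
    realisationHom_formalOp (fun i X hX => List.mem_append_right _ hX)] at this
  rw [momentEntry, momentEntry, this]

end Algebraic

/-! ### Decoding a walk by the Euclidean algorithm. -/

section Walks

/-- The vector obtained by applying the transfer matrices `!![1, a; b, a * b + 1]` of the
steps `a → b` of a walk to `(1, 1)`. -/
def walkVec : List ℕ → ℕ × ℕ
  | [] => (1, 1)
  | [_] => (1, 1)
  | a :: b :: l =>
    let x := walkVec (b :: l)
    (x.1 + a * x.2, b * (x.1 + a * x.2) + x.2)

theorem walkVec_cons_cons (a b : ℕ) (l : List ℕ) :
    walkVec (a :: b :: l) = ((walkVec (b :: l)).1 + a * (walkVec (b :: l)).2,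
      b * ((walkVec (b :: l)).1 + a * (walkVec (b :: l)).2) + (walkVec (b :: l)).2) := rfl

theorem walkVec_pos (l : List ℕ) : 0 < (walkVec l).1 ∧ 0 < (walkVec l).2 := by
  induction l with
  | nil => simp [walkVec]
  | cons a l ih =>
    cases l with
    | nil => simp [walkVec]
    | cons b l => rw [walkVec_cons_cons]; constructor <;> dsimp only <;> omega

/-- A walk with positive labels can be read off from its start and the slope of its vector. -/
theorem eq_of_walkVec_proportional {l l' : List ℕ} {a : ℕ} (ha : 0 < a) (hl : ∀ b ∈ l, 0 < b)
    (hl' : ∀ b ∈ l', 0 < b)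
    (h : (walkVec (a :: l)).1 * (walkVec (a :: l')).2 =
      (walkVec (a :: l)).2 * (walkVec (a :: l')).1) : l = l' := by
  -- A walk with at least one step has slope above `1`, the slope of `(1, 1)`; this detects where a
  -- walk ends.
  have hne : ∀ {b l}, 0 < b → (walkVec (a :: b :: l)).1 < (walkVec (a :: b :: l)).2 := by
    intro b l hb
    rw [walkVec_cons_cons]
    have := walkVec_pos (b :: l)
    dsimp only
    nlinarith [Nat.zero_le (a * (walkVec (b :: l)).2)]
  induction l generalizing l' a with
  | nil =>
    cases l' with
    | nil => rfl
    | cons b l' =>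
      have := hne (b := b) (l := l') (hl' b (by simp))
      simp only [walkVec, one_mul] at h this
      omega
  | cons b l ih =>
    cases l' with
    | nil =>
      have := hne (b := b) (l := l) (hl b (by simp))
      simp only [walkVec, mul_one] at h this
      omega
    | cons b' l' =>
      -- With `(x, y)` the vector of the tail and `u = x + a * y`, the new vector is `(u, b * u +
      -- y)` and `y < u`. Hence `b` is the quotient and `y` the remainder.
      have hdiv : ∀ {b l}, (walkVec (a :: b :: l)).2 / (walkVec (a :: b :: l)).1 = b := by
        intro b l
        have := walkVec_pos (b :: l)
        rw [walkVec_cons_cons]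
        dsimp only
        rw [mul_comm, Nat.mul_add_div (by omega), Nat.div_eq_of_lt, add_zero]
        nlinarith
      have hb : b = b' := by
        rw [← hdiv (b := b) (l := l), ← hdiv (b := b') (l := l'),
          ← Nat.mul_div_mul_right _ _ (walkVec_pos (a :: b' :: l')).1, ← h,
          Nat.mul_div_mul_left _ _ (walkVec_pos (a :: b :: l)).1]
      subst hb
      congr 1
      refine ih (hl b (by simp)) (fun c hc => hl c (by simp [hc]))
        (fun c hc => hl' c (by simp [hc])) ?_ ?_
      · simp only [walkVec_cons_cons] at h
        zify at h ⊢
        linear_combination h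
      · intro c l hc
        rw [walkVec_cons_cons]
        have := walkVec_pos (c :: l)
        dsimp only
        nlinarith [Nat.zero_le (b * (walkVec (c :: l)).2)]

end Walks

/-! ### Prescribing a Gram matrix near the identity. -/

section Gram

open scoped Matrix.Norms.L2Operator MatrixOrder in
/-- A small Hermitian perturbation of the identity is the Gram matrix of a basis. -/
theorem exists_gram_eq {ι : Type*} [Fintype ι] [DecidableEq ι] {H : Matrix ι ι ℂ}
    (hH : H.IsHermitian) :
    ∃ ε : ℂ, ε ≠ 0 ∧ ∃ B : Matrix ι ι ℂ, IsUnit B ∧ Bᴴ * B = 1 + ε • H := by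
  -- From `-‖H‖ ≤ H`, the matrix `1 + ‖H‖ + H` is positive definite; dividing by `‖H‖ + 1` gives `ε
  -- = (‖H‖ + 1)⁻¹`.
  have h1 : -algebraMap ℝ (Matrix ι ι ℂ) ‖H‖ ≤ H :=
    IsSelfAdjoint.neg_algebraMap_norm_le_self hH
  have h2 : (H + algebraMap ℝ (Matrix ι ι ℂ) ‖H‖).PosSemidef := by
    rw [Matrix.le_iff, sub_neg_eq_add] at h1
    exact h1
  have hc : (0 : ℝ) < ‖H‖ + 1 := by positivity
  have h3 : (1 + (H + algebraMap ℝ (Matrix ι ι ℂ) ‖H‖)).PosDef :=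
    Matrix.PosDef.one.add_posSemidef h2
  have h4 : ((‖H‖ + 1)⁻¹ • (1 + (H + algebraMap ℝ (Matrix ι ι ℂ) ‖H‖))).PosDef :=
    h3.smul (inv_pos.mpr hc)
  have h5 : (‖H‖ + 1)⁻¹ • (1 + (H + algebraMap ℝ (Matrix ι ι ℂ) ‖H‖)) =
      1 + (((‖H‖ + 1)⁻¹ : ℝ) : ℂ) • H := by
    rw [Complex.coe_smul, Algebra.algebraMap_eq_smul_one]
    have : (1 : Matrix ι ι ℂ) = ((‖H‖ + 1)⁻¹ * (‖H‖ + 1)) • (1 : Matrix ι ι ℂ) := by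
      rw [inv_mul_cancel₀ hc.ne', one_smul]
    conv_rhs => rw [this]
    module
  rw [h5] at h4
  refine ⟨_, Complex.ofReal_ne_zero.mpr (inv_pos.mpr hc).ne', ?_⟩
  obtain ⟨B, hB⟩ := CStarAlgebra.nonneg_iff_eq_star_mul_self.mp h4.posSemidef.nonneg
  rw [Matrix.star_eq_conjTranspose] at hB
  refine ⟨B, ?_, hB.symm⟩
  have := h4.isUnit
  rw [hB] at this
  exact isUnit_of_mul_isUnit_right this

end Gram

/-! ### Projectors whose products remember walks. -/

section WalkProjectors

variable {V κ : Type*}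

/-- The transfer matrix of a step between vertices with labels `a` and `b`. -/
def stepMatrix (a b : ℕ) : Matrix (Fin 2) (Fin 2) ℂ := !![1, (a : ℂ); (b : ℂ), a * b + 1]

/-- The block matrix having the transfer matrices of the edges of a graph as its blocks. -/
def edgeMatrix (κ : Type*) (G : SimpleGraph V) [DecidableRel G.Adj] (lab : V → ℕ) :
    Matrix (V × (Fin 2 ⊕ κ)) (V × (Fin 2 ⊕ κ)) ℂ :=
  Matrix.of fun x y => if G.Adj x.1 y.1 then
    Matrix.fromBlocks (stepMatrix (lab x.1) (lab y.1)) 0 0 (0 : Matrix κ κ ℂ) x.2 y.2 else 0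

/-- Reversing an edge transposes its step matrix, whose entries are real. -/
theorem edgeMatrix_isHermitian (G : SimpleGraph V) [DecidableRel G.Adj] (lab : V → ℕ) :
    (edgeMatrix κ G lab).IsHermitian := by
  ext ⟨a, i⟩ ⟨b, j⟩
  simp only [edgeMatrix, Matrix.conjTranspose_apply, Matrix.of_apply, G.adj_comm b a]
  split_ifs with h
  · rcases i with i | i <;> rcases j with j | j <;> try simp
    fin_cases i <;> fin_cases j <;> simp [stepMatrix, mul_comm]
  · simp

variable [DecidableEq V]

/-- The coordinate projection onto the block of a vertex. -/
def siteProj (κ : Type*) [DecidableEq κ] (a : V) : Matrix (V × (Fin 2 ⊕ κ)) (V × (Fin 2 ⊕ κ)) ℂ :=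
  Matrix.diagonal fun x => if x.1 = a then 1 else 0

/-- A vector supported on the first two coordinates of the block of a vertex. -/
def siteVec (κ : Type*) (a : V) (y : Fin 2 → ℂ) : V × (Fin 2 ⊕ κ) → ℂ :=
  fun x => if x.1 = a then Sum.elim y 0 x.2 else 0

variable [DecidableEq κ]

theorem siteProj_conjTranspose (a : V) : (siteProj κ a)ᴴ = siteProj κ a := by
  rw [siteProj, Matrix.diagonal_conjTranspose]
  congr 1
  funext x
  by_cases hx : x.1 = a <;> simp [hx]

variable [Fintype V] [Fintype κ]

theorem siteProj_mul_self (a : V) : siteProj κ a * siteProj κ a = siteProj κ a := by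
  simp [siteProj, Matrix.diagonal_mul_diagonal]

theorem siteProj_mul_of_ne {a b : V} (h : a ≠ b) : siteProj κ a * siteProj κ b = 0 := by
  rw [siteProj, siteProj, Matrix.diagonal_mul_diagonal, Matrix.diagonal_eq_zero]
  funext x
  by_cases hx : x.1 = a <;> simp [hx, h]

theorem siteProj_mul_edgeMatrix_mul (G : SimpleGraph V) [DecidableRel G.Adj] (lab : V → ℕ)
    {a b : V} (h : ¬ G.Adj a b) : siteProj κ a * edgeMatrix κ G lab * siteProj κ b = 0 := by
  ext x y
  rw [siteProj, siteProj, Matrix.mul_diagonal, Matrix.diagonal_mul]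
  by_cases hx : x.1 = a <;> by_cases hy : y.1 = b <;> simp [hx, hy, edgeMatrix, h]

theorem rank_siteProj (a : V) : (siteProj κ a).rank = Fintype.card κ + 2 := by
  rw [siteProj, Matrix.rank_diagonal]
  have : Fintype.card (Fin 2 ⊕ κ) = Fintype.card κ + 2 := by simp [add_comm]
  rw [← this]
  refine Fintype.card_congr ⟨fun x => x.1.2, fun i => ⟨(a, i), by simp⟩, ?_, ?_⟩
  · rintro ⟨⟨b, i⟩, h⟩
    have : b = a := by simpa using h
    simp [this]
  · intro i
    rfl

theorem siteProj_mulVec_siteVec (a b : V) (y : Fin 2 → ℂ) :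
    siteProj κ a *ᵥ siteVec κ b y = if a = b then siteVec κ a y else 0 := by
  funext x
  rw [siteProj, Matrix.mulVec_diagonal]
  by_cases hab : a = b
  · subst hab
    by_cases hx : x.1 = a <;> simp [siteVec, hx]
  · by_cases hx : x.1 = a <;> simp [siteVec, hx, hab]

theorem siteProj_mulVec_edgeMatrix_mulVec (G : SimpleGraph V) [DecidableRel G.Adj]
    (lab : V → ℕ) {a b : V} (h : G.Adj a b) (y : Fin 2 → ℂ) :
    siteProj κ a *ᵥ (edgeMatrix κ G lab *ᵥ siteVec κ b y) =
      siteVec κ a (stepMatrix (lab a) (lab b) *ᵥ y) := by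
  funext ⟨c, i⟩
  rw [siteProj, Matrix.mulVec_diagonal]
  by_cases hc : c = a
  · subst hc
    simp only [Matrix.mulVec, dotProduct, Fintype.sum_prod_type, siteVec, edgeMatrix,
      Matrix.of_apply, if_true, one_mul]
    rw [Finset.sum_eq_single b (fun c _ hc => by simp [hc]) (by simp)]
    rcases i with i | i
    · fin_cases i <;> simp [h]
    · simp [h]
  · simp [siteVec, hc]

/-- The complex vector of a walk. -/
def walkVecC (l : List ℕ) : Fin 2 → ℂ := ![((walkVec l).1 : ℂ), ((walkVec l).2 : ℂ)]

theorem stepMatrix_mulVec_walkVecC (a b : ℕ) (l : List ℕ) :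
    stepMatrix a b *ᵥ walkVecC (b :: l) = walkVecC (a :: b :: l) := by
  funext i
  fin_cases i
  · simp [stepMatrix, walkVecC, walkVec_cons_cons, mul_comm]
  · simp [stepMatrix, walkVecC, walkVec_cons_cons]
    ring

/-- For every graph there are projectors of any given rank at least two, indexed by the vertices
and linearly independent, which are orthogonal at non-adjacent vertices and whose products along
distinct walks are never proportional. -/
theorem exists_walk_projectors (κ : Type*) [Fintype κ] [DecidableEq κ] (G : SimpleGraph V)
    {lab : V → ℕ} (hinj : Function.Injective lab) (hpos : ∀ a, 0 < lab a) :
    ∃ Q : V → Matrix (V × (Fin 2 ⊕ κ)) (V × (Fin 2 ⊕ κ)) ℂ,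
      (∀ a, IsStarProjection (Q a)) ∧ (∀ a, (Q a).rank = Fintype.card κ + 2) ∧
      LinearIndependent ℂ Q ∧ (∀ a b, a ≠ b → ¬ G.Adj a b → Q a * Q b = 0) ∧
      (∀ w : List V, w ≠ [] → w.IsChain G.Adj → (w.map Q).prod ≠ 0) ∧
      (∀ w w' : List V, w ≠ [] → w' ≠ [] → w.IsChain G.Adj → w'.IsChain G.Adj →
        ∀ c : ℂ, (w.map Q).prod = c • (w'.map Q).prod → w = w') := by
  classical
  obtain ⟨ε, hε, B, hB, hG⟩ := exists_gram_eq (edgeMatrix_isHermitian (κ := κ) G lab)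
  have hBH : IsUnit Bᴴ := hB.star
  have hinjB : Function.Injective B.mulVec := Matrix.mulVec_injective_of_isUnit hB
  -- A vertex has no loop, so the perturbation drops out of `Q a * Q a` and idempotence survives.
  have hdiag : ∀ a, siteProj κ a * edgeMatrix κ G lab * siteProj κ a = 0 :=
    fun a => siteProj_mul_edgeMatrix_mul G lab (G.loopless.irrefl a)
  have hQQ : ∀ a b, B * siteProj κ a * Bᴴ * (B * siteProj κ b * Bᴴ) =
      B * (siteProj κ a * siteProj κ b +
        ε • (siteProj κ a * edgeMatrix κ G lab * siteProj κ b)) * Bᴴ := by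
    intro a b
    calc B * siteProj κ a * Bᴴ * (B * siteProj κ b * Bᴴ)
        = B * (siteProj κ a * (Bᴴ * B) * siteProj κ b) * Bᴴ := by simp only [mul_assoc]
      _ = _ := by
        rw [hG, mul_add, add_mul, mul_one, Matrix.mul_smul, Matrix.smul_mul]
  -- `z` is chosen so that `Bᴴ` sends it to the starting vector `(1, 1)` at every vertex at once.
  obtain ⟨z, hz⟩ : ∃ z, Bᴴ *ᵥ z = fun x => Sum.elim (fun _ => (1 : ℂ)) 0 x.2 :=
    Matrix.mulVec_surjective_iff_isUnit.mpr hBH _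
  -- Consecutive vertices differ, so the identity part of `Bᴴ * B` vanishes between their site
  -- projections; each step contributes one `ε` and one step matrix.
  have hwalk : ∀ (l : List V) (a : V), (a :: l).IsChain G.Adj →
      ((a :: l).map fun a => B * siteProj κ a * Bᴴ).prod *ᵥ z =
        ε ^ l.length • (B *ᵥ siteVec κ a (walkVecC ((a :: l).map lab))) := by
    intro l
    induction l with
    | nil =>
      intro a _
      simp only [List.map_cons, List.map_nil, List.prod_cons, List.prod_nil, mul_one,
        List.length_nil, pow_zero, one_smul]
      rw [← Matrix.mulVec_mulVec, hz, ← Matrix.mulVec_mulVec]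
      congr 1
      funext ⟨b, i⟩
      rw [siteProj, Matrix.mulVec_diagonal]
      by_cases hb : b = a
      · rcases i with i | i
        · fin_cases i <;> simp [siteVec, hb, walkVecC, walkVec]
        · simp [siteVec, hb]
      · simp [siteVec, hb]
    | cons b l ih =>
      intro a h
      rw [List.isChain_cons_cons] at h
      rw [List.map_cons, List.prod_cons, ← Matrix.mulVec_mulVec, ih b h.2, Matrix.mulVec_smul,
        List.length_cons, pow_succ, mul_smul]
      congr 1
      rw [Matrix.mulVec_mulVec, mul_assoc, hG, ← Matrix.mulVec_mulVec, ← Matrix.mulVec_mulVec,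
        Matrix.add_mulVec, Matrix.one_mulVec,
        Matrix.smul_mulVec, Matrix.mulVec_add, siteProj_mulVec_siteVec, if_neg h.1.ne, zero_add,
        Matrix.mulVec_smul, siteProj_mulVec_edgeMatrix_mulVec G lab h.1, Matrix.mulVec_smul,
        List.map_cons, stepMatrix_mulVec_walkVecC, ← List.map_cons, ← List.map_cons]
  have hsite : ∀ (a : V) (l : List ℕ), siteVec κ a (walkVecC l) (a, Sum.inl 0) ≠ 0 := by
    intro a l
    simpa [siteVec, walkVecC] using (walkVec_pos l).1.ne'
  refine ⟨fun a => B * siteProj κ a * Bᴴ, fun a => ⟨?_, ?_⟩, fun a => ?_, ?_, fun a b hab h => ?_,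
    fun w hw hc h0 => ?_, fun w w' hw hw' hc hc' c h => ?_⟩
  · change _ * _ = _
    rw [hQQ, siteProj_mul_self, hdiag, smul_zero, add_zero]
  · change star (B * siteProj κ a * Bᴴ) = B * siteProj κ a * Bᴴ
    rw [Matrix.star_eq_conjTranspose, Matrix.conjTranspose_mul, Matrix.conjTranspose_mul,
      Matrix.conjTranspose_conjTranspose, siteProj_conjTranspose, mul_assoc]
  · rw [Matrix.rank_mul_eq_left_of_isUnit_det _ _ ((Matrix.isUnit_iff_isUnit_det _).mp hBH),
      Matrix.rank_mul_eq_right_of_isUnit_det _ _ ((Matrix.isUnit_iff_isUnit_det _).mp hB),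
      rank_siteProj]
  · rw [Fintype.linearIndependent_iff]
    intro g hg a
    have h1 : B * (∑ b, g b • siteProj κ b) * Bᴴ = 0 := by
      rw [← hg, Finset.mul_sum, Finset.sum_mul]
      simp only [Matrix.mul_smul, Matrix.smul_mul]
    have h2 : ∑ b, g b • siteProj κ b = 0 :=
      (hB.mul_right_eq_zero).mp ((hBH.mul_left_eq_zero).mp h1)
    have h3 := congrFun (congrFun h2 (a, Sum.inl 0)) (a, Sum.inl 0)
    simpa [Matrix.sum_apply, siteProj] using h3
  · rw [hQQ, siteProj_mul_of_ne hab, siteProj_mul_edgeMatrix_mul G lab h]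
    simp
  · cases w with
    | nil => exact hw rfl
    | cons a l =>
      have h1 := hwalk l a hc
      rw [h0, Matrix.zero_mulVec, eq_comm, smul_eq_zero_iff_right (pow_ne_zero _ hε)] at h1
      have h2 := hinjB (h1.trans (Matrix.mulVec_zero B).symm)
      exact hsite a _ (congrFun h2 _)
  · cases w with
    | nil => exact absurd rfl hw
    | cons a l =>
    cases w' with
    | nil => exact absurd rfl hw'
    | cons a' l' =>
      have h1 := hwalk l a hc
      rw [h, Matrix.smul_mulVec, hwalk l' a' hc', ← Matrix.mulVec_smul, ← Matrix.mulVec_smul,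
        ← Matrix.mulVec_smul] at h1
      have h2 := hinjB h1
      -- The site carrying the vector is the first vertex of the walk.
      have haa : a = a' := by
        by_contra hne
        have h3 := congrFun h2 (a, Sum.inl 0)
        simp only [Pi.smul_apply, smul_eq_mul] at h3
        refine mul_ne_zero (pow_ne_zero l.length hε) (hsite a _) (h3.symm.trans ?_)
        simp [siteVec, hne]
      subst haa
      have h3 := congrFun h2 (a, Sum.inl 0)
      have h4 := congrFun h2 (a, Sum.inl 1)
      simp only [Pi.smul_apply, smul_eq_mul, siteVec, walkVecC, if_true, Sum.elim_inl,
        Matrix.cons_val_zero, Matrix.cons_val_one, List.map_cons] at h3 h4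
      -- Cross-multiplying the two coordinates eliminates `c` and the powers of `ε`, which may
      -- differ between the walks.
      have h5 : ((walkVec (lab a :: l.map lab)).1 : ℂ) * (walkVec (lab a :: l'.map lab)).2 =
          (walkVec (lab a :: l.map lab)).2 * (walkVec (lab a :: l'.map lab)).1 := by
        refine mul_left_cancel₀ (pow_ne_zero l.length hε) ?_
        rw [← mul_assoc, ← mul_assoc, ← h3, ← h4]
        ring
      have h6 := eq_of_walkVec_proportional (hpos a)
        (fun b hb => by obtain ⟨x, -, rfl⟩ := List.mem_map.mp hb; exact hpos x)
        (fun b hb => by obtain ⟨x, -, rfl⟩ := List.mem_map.mp hb; exact hpos x)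
        (by exact_mod_cast h5)
      rw [hinj.list_map h6]

end WalkProjectors

/-- The projectors of `exists_walk_projectors` as operators on some `ℂ ^ n`. -/
theorem exists_walk_projectors_op {V : Type*} [Fintype V] (G : SimpleGraph V)
    {lab : V → ℕ} (hinj : Function.Injective lab) (hpos : ∀ a, 0 < lab a) {s : ℕ} (hs : 2 ≤ s) :
    ∃ Q : V → Op (Fintype.card V * s),
      (∀ a, IsStarProjection (Q a)) ∧ (∀ a, (Q a).rank = s) ∧
      LinearIndependent ℂ Q ∧ (∀ a b, a ≠ b → ¬ G.Adj a b → Q a * Q b = 0) ∧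
      (∀ w : List V, w ≠ [] → w.IsChain G.Adj → (w.map Q).prod ≠ 0) ∧
      (∀ w w' : List V, w ≠ [] → w' ≠ [] → w.IsChain G.Adj → w'.IsChain G.Adj →
        ∀ c : ℂ, (w.map Q).prod = c • (w'.map Q).prod → w = w') := by
  classical
  obtain ⟨Q, hproj, hrank, hind, horth, hne, hsep⟩ :=
    exists_walk_projectors (Fin (s - 2)) G hinj hpos
  let e : V × (Fin 2 ⊕ Fin (s - 2)) ≃ Fin (Fintype.card V * s) :=
    Fintype.equivOfCardEq (by simp; left; omega)
  let f := Matrix.reindexAlgEquiv ℂ ℂ e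
  have hf : ∀ w : List V, (w.map fun a => f (Q a)).prod = f (w.map Q).prod := by
    intro w
    rw [map_list_prod, List.map_map]
    rfl
  refine ⟨fun a => f (Q a), fun a => ⟨?_, ?_⟩, fun a => ?_, ?_, fun a b hab h => ?_,
    fun w hw hc h0 => ?_, fun w w' hw hw' hc hc' c h => ?_⟩
  · exact (hproj a).isIdempotentElem.map f
  · have := (hproj a).isSelfAdjoint.star_eq
    rw [Matrix.star_eq_conjTranspose] at this
    change (Matrix.reindex e e (Q a))ᴴ = Matrix.reindex e e (Q a)
    rw [Matrix.conjTranspose_reindex, this]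
  · change (Matrix.reindex e e (Q a)).rank = s
    rw [Matrix.rank_reindex, hrank, Fintype.card_fin]
    omega
  · exact hind.map' f.toLinearMap (LinearMap.ker_eq_bot.mpr f.injective)
  · rw [← map_mul, horth a b hab h, map_zero]
  · rw [hf, map_eq_zero_iff f f.injective] at h0
    exact hne w hw hc h0
  · rw [hf, hf, ← map_smul] at h
    exact hsep w w' hw hw' hc hc' c (f.injective h)

/-! ### Realisations separating two blocks. -/

section Blocks

theorem blockNorm_of_forall_eq_one {d : ℕ} {P : List (Op d)} (h : ∀ X ∈ P, X = 1) :
    blockNorm P = 0 :=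
  if_pos (List.prod_eq_one h)

theorem ne_zero_of_rank {d r : ℕ} (hr : 1 ≤ r) {X : Op d} (h : X.rank = r) : X ≠ 0 := by
  rintro rfl
  rw [Matrix.rank_zero] at h
  omega

theorem eq_one_of_rank_eq {d : ℕ} {X : Op d} (hX : IsStarProjection X) (h : X.rank = d) :
    X = 1 := by
  have hli : LinearIndependent ℂ X.row := by
    rw [linearIndependent_iff_card_eq_finrank_span, Fintype.card_fin, Set.finrank,
      ← Matrix.rank_eq_finrank_span_row, h]
  have hu : IsUnit X := Matrix.linearIndependent_rows_iff_isUnit.mp hli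
  exact hu.mul_left_cancel (by rw [mul_one]; exact hX.isIdempotentElem)

/-- The image of a block under a map respecting coincidences and orthogonality. -/
theorem IsBlock.map {d n r s : ℕ} {P : List (Op d)} (hP : IsBlock r P) {φ : Op d → Op n}
    (hproj : ∀ X ∈ P, IsStarProjection (φ X)) (hrank : ∀ X ∈ P, (φ X).rank = s)
    (hind : LinearIndepOn ℂ id {X : Op n | X ∈ P.map φ})
    (hco : ∀ X ∈ P, ∀ Y ∈ P, φ X = φ Y → X = Y)
    (horth : ∀ X ∈ P, ∀ Y ∈ P, φ X * φ Y = 0 → X * Y = 0) : IsBlock s (P.map φ) where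
  projector := by simpa using hproj
  rank_eq := by simpa using hrank
  independent := hind
  simplified := by
    rw [IsSimplified, List.isChain_map]
    refine List.IsChain.imp_of_mem_imp (fun X Y hX hY h => ?_) hP.simplified
    exact ⟨fun h0 => h.1 (horth X hX Y hY h0), fun h0 => h.2 (hco X hX Y hY h0)⟩

/-- Blocks one of which contains the identity have a realisation by identities. -/
theorem exists_realisation_of_one_mem {d : ℕ} {r s : ℕ} (hs : 1 ≤ s)
    {P P' : List (Op d)} (hP : IsBlock r P) (hP' : IsBlock r P') (h1 : 1 ∈ P ++ P') :
    (∀ X ∈ P ++ P', X = 1) ∧ IsBlock s (P.map fun _ => (1 : Op s)) ∧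
      IsBlock s (P'.map fun _ => (1 : Op s)) := by
  have hrank : ∀ X ∈ P ++ P', X.rank = r := by
    intro X hX
    rcases List.mem_append.mp hX with hX | hX
    · exact hP.rank_eq X hX
    · exact hP'.rank_eq X hX
  have hr : d = r := by
    rw [← hrank 1 h1, Matrix.rank_one, Fintype.card_fin]
  have hall : ∀ X ∈ P ++ P', X = 1 := by
    intro X hX
    refine eq_one_of_rank_eq ?_ ((hrank X hX).trans hr.symm)
    rcases List.mem_append.mp hX with hX | hX
    · exact hP.projector X hX
    · exact hP'.projector X hX
  have : NeZero s := ⟨by omega⟩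
  have key : ∀ {Q : List (Op d)}, IsBlock r Q → (∀ X ∈ Q, X = 1) →
      IsBlock s (Q.map fun _ => (1 : Op s)) := by
    intro Q hQ hQ1
    refine hQ.map (fun _ _ => .one _) (fun _ _ => by simp) ?_
      (fun X hX Y hY _ => (hQ1 X hX).trans (hQ1 Y hY).symm)
      (fun _ _ _ _ h => absurd h (by simp))
    refine LinearIndepOn.mono
      (LinearIndepOn.singleton (v := id) (i := (1 : Op s)) one_ne_zero) ?_
    intro X hX
    obtain ⟨_, _, rfl⟩ := List.mem_map.mp hX
    rfl
  exact ⟨hall, key hP fun X hX => hall X (List.mem_append_left _ hX),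
    key hP' fun X hX => hall X (List.mem_append_right _ hX)⟩

/-- Two blocks have a realisation of any rank at least two whose operators are nonzero, and
proportional only if the blocks agree. -/
theorem exists_separating_realisation {d : ℕ} (hd : 0 < d) {r s : ℕ} (hr : 1 ≤ r) (hs : 2 ≤ s)
    {P P' : List (Op d)} (hP : IsBlock r P) (hP' : IsBlock r P') :
    ∃ (n : ℕ) (φ : Op d → Op n), IsBlock s (P.map φ) ∧ IsBlock s (P'.map φ) ∧
      (∀ X ∈ P ++ P', ∀ Y ∈ P ++ P', (φ X = φ Y ↔ X = Y)) ∧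
      (∀ X ∈ P ++ P', ∀ Y ∈ P ++ P', (φ X * φ Y = 0 ↔ X * Y = 0)) ∧
      (∀ X ∈ P ++ P', (φ X = 1 ↔ X = 1)) ∧
      blockOp (P.map φ) ≠ 0 ∧ blockOp (P'.map φ) ≠ 0 ∧
      (∀ c : ℂ, c ≠ 0 → blockOp (P.map φ) = c • blockOp (P'.map φ) →
        blockNorm P = blockNorm P' ∧ ∀ j < blockNorm P, P[j]? = P'[j]?) := by
  classical
  have hdz : NeZero d := ⟨hd.ne'⟩
  have hsz : NeZero s := ⟨by omega⟩
  -- An identity forces `r = d`, and then every projector present is the identity and both norms are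
  -- `0`.
  by_cases h1 : 1 ∈ P ++ P'
  · obtain ⟨hall, hb, hb'⟩ := exists_realisation_of_one_mem (by omega : 1 ≤ s) hP hP' h1
    have hn : blockNorm P = 0 :=
      blockNorm_of_forall_eq_one fun X hX => hall X (List.mem_append_left _ hX)
    have hn' : blockNorm P' = 0 :=
      blockNorm_of_forall_eq_one fun X hX => hall X (List.mem_append_right _ hX)
    refine ⟨s, fun _ => 1, hb, hb', fun X hX Y hY => ?_, fun X hX Y hY => ?_, fun X hX => ?_,
      ?_, ?_, fun _ _ _ => ⟨hn.trans hn'.symm, fun j hj => by omega⟩⟩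
    · simp [hall X hX, hall Y hY]
    · simp [hall X hX, hall Y hY]
    · simp [hall X hX]
    · simp [blockOp]
    · simp [blockOp]
  let L := P ++ P'
  have hLproj : ∀ X ∈ L, IsStarProjection X := by
    intro X hX
    rcases List.mem_append.mp hX with hX | hX
    · exact hP.projector X hX
    · exact hP'.projector X hX
  have hLne : ∀ X ∈ L, X ≠ 0 := by
    intro X hX
    rcases List.mem_append.mp hX with hX | hX
    · exact ne_zero_of_rank hr (hP.rank_eq X hX)
    · exact ne_zero_of_rank hr (hP'.rank_eq X hX)
  have hLsymm : ∀ X ∈ L, ∀ Y ∈ L, X * Y = 0 → Y * X = 0 := by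
    intro X hX Y hY h
    rw [← (hLproj X hX).isSelfAdjoint.star_eq, ← (hLproj Y hY).isSelfAdjoint.star_eq,
      ← star_mul, h, star_zero]
  -- One vertex for each projector of the blocks, and an isolated one.
  let G : SimpleGraph (Option {X // X ∈ L.toFinset}) := SimpleGraph.fromRel fun a b =>
    ∃ X Y, a = some X ∧ b = some Y ∧ X.1 * Y.1 ≠ 0
  obtain ⟨lab, hlab, hpos⟩ : ∃ lab : Option {X // X ∈ L.toFinset} → ℕ,
      Function.Injective lab ∧ ∀ a, 0 < lab a :=
    -- The shift by one makes labels positive, as the Euclidean decoding requires.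
    ⟨fun a => (Fintype.equivFin _ a : ℕ) + 1, fun a b h =>
      (Fintype.equivFin _).injective (Fin.ext (Nat.succ_injective h)), fun a => Nat.succ_pos _⟩
  obtain ⟨Q, hproj, hrank, hind, horth, hne, hsep⟩ := exists_walk_projectors_op G hlab hpos hs
  let f : Op d → Option {X // X ∈ L.toFinset} := fun X =>
    if h : X ∈ L.toFinset then some ⟨X, h⟩ else none
  have hf : ∀ X, (h : X ∈ L) → f X = some ⟨X, List.mem_toFinset.mpr h⟩ :=
    fun X h => dif_pos (List.mem_toFinset.mpr h)
  have hfinj : ∀ X ∈ L, ∀ Y ∈ L, f X = f Y → X = Y := by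
    intro X hX Y hY h
    rw [hf X hX, hf Y hY] at h
    simpa using h
  have hadj : ∀ X ∈ L, ∀ Y ∈ L, (G.Adj (f X) (f Y) ↔ X ≠ Y ∧ X * Y ≠ 0) := by
    intro X hX Y hY
    rw [SimpleGraph.fromRel_adj, hf X hX, hf Y hY]
    constructor
    · rintro ⟨hXY, h⟩
      refine ⟨fun h => hXY (by subst h; rfl), ?_⟩
      rcases h with ⟨A, B, hA, hB, h⟩ | ⟨A, B, hA, hB, h⟩
      · rw [Option.some.injEq] at hA hB
        subst hA hB
        exact h
      · rw [Option.some.injEq] at hA hB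
        subst hA hB
        exact fun h0 => h (hLsymm X hX Y hY h0)
    · rintro ⟨hXY, h⟩
      exact ⟨by simpa using hXY, Or.inl ⟨_, _, rfl, rfl, h⟩⟩
  have hQinj : Function.Injective Q := hind.injective
  have hco : ∀ X ∈ L, ∀ Y ∈ L, (Q (f X) = Q (f Y) ↔ X = Y) := fun X hX Y hY =>
    ⟨fun h => hfinj X hX Y hY (hQinj h), fun h => by rw [h]⟩
  have hor : ∀ X ∈ L, ∀ Y ∈ L, (Q (f X) * Q (f Y) = 0 ↔ X * Y = 0) := by
    intro X hX Y hY
    by_cases hXY : X = Y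
    · subst hXY
      rw [(hproj (f X)).isIdempotentElem.eq, (hLproj X hX).isIdempotentElem.eq]
      exact iff_of_false (ne_zero_of_rank (by omega) (hrank _)) (hLne X hX)
    · constructor
      · intro h
        by_contra h0
        refine hne [f X, f Y] (by simp) (by simpa using (hadj X hX Y hY).mpr ⟨hXY, h0⟩) ?_
        simpa using h
      · intro h
        refine horth _ _ (fun h0 => hXY (hfinj X hX Y hY h0)) fun h0 => ?_
        exact ((hadj X hX Y hY).mp h0).2 h
  have hQone : ∀ X ∈ L, Q (f X) ≠ 1 := by
    intro X hX h
    have h2 := hrank (f X)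
    -- The isolated vertex makes the dimension at least `2 * s`, too large for a rank-`s` identity.
    have h3 : 1 < Fintype.card (Option {X // X ∈ L.toFinset}) :=
      Fintype.one_lt_card_iff.mpr ⟨f X, none, by rw [hf X hX]; simp⟩
    rw [h, Matrix.rank_one, Fintype.card_fin] at h2
    nlinarith
  have hblock : ∀ {R : List (Op d)}, IsBlock r R → (∀ X ∈ R, X ∈ L) →
      IsBlock s (R.map fun X => Q (f X)) := by
    intro R hR hRL
    refine hR.map (fun _ _ => hproj _) (fun _ _ => hrank _) ?_
      (fun X hX Y hY h => (hco X (hRL X hX) Y (hRL Y hY)).mp h)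
      (fun X hX Y hY h => (hor X (hRL X hX) Y (hRL Y hY)).mp h)
    refine hind.linearIndepOn_id.mono ?_
    intro X hX
    obtain ⟨Y, _, rfl⟩ := List.mem_map.mp hX
    exact ⟨f Y, rfl⟩
  have hchain : ∀ {R : List (Op d)}, IsBlock r R → (∀ X ∈ R, X ∈ L) →
      (R.map f).IsChain G.Adj := by
    intro R hR hRL
    rw [List.isChain_map]
    exact List.IsChain.imp_of_mem_imp (fun X Y hX hY h =>
      (hadj X (hRL X hX) Y (hRL Y hY)).mpr h.symm) hR.simplified
  have hop : ∀ R : List (Op d), blockOp (R.map fun X => Q (f X)) = ((R.map f).map Q).prod := by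
    intro R
    rw [blockOp, List.map_map]
    rfl
  have hPL : ∀ X ∈ P, X ∈ L := fun X hX => List.mem_append_left _ hX
  have hPL' : ∀ X ∈ P', X ∈ L := fun X hX => List.mem_append_right _ hX
  have hnz : NeZero (Fintype.card (Option {X // X ∈ L.toFinset}) * s) :=
    ⟨Nat.mul_ne_zero Fintype.card_ne_zero (by omega)⟩
  have hnonzero : ∀ {R : List (Op d)}, IsBlock r R → (∀ X ∈ R, X ∈ L) →
      blockOp (R.map fun X => Q (f X)) ≠ 0 := by
    intro R hR hRL
    by_cases h0 : R = []
    · simp [h0, blockOp]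
    · rw [hop]
      exact hne _ (by simpa using h0) (hchain hR hRL)
  -- The operator of a nonempty block is annihilated by `1 - Q a`, `a` its first vertex.
  have hscalar : ∀ {R : List (Op d)}, (∀ X ∈ R, X ∈ L) → ∀ c : ℂ, c ≠ 0 →
      blockOp (R.map fun X => Q (f X)) = c • 1 → R = [] := by
    intro R hRL c hc h
    cases R with
    | nil => rfl
    | cons X R =>
      rw [blockOp, List.map_cons, List.prod_cons] at h
      have h2 : Q (f X) * (c • 1) = c • 1 := by
        rw [← h, ← mul_assoc, (hproj (f X)).isIdempotentElem.eq]
      rw [Matrix.mul_smul, mul_one] at h2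
      exact absurd (smul_right_injective _ hc h2) (hQone X (hRL X (by simp)))
  refine ⟨_, fun X => Q (f X), hblock hP hPL, hblock hP' hPL', hco, hor, fun X hX => ?_,
    hnonzero hP hPL, hnonzero hP' hPL', fun c hc h => ?_⟩
  · exact iff_of_false (hQone X hX) fun h => h1 (h ▸ hX)
  · suffices e : P = P' by rw [e]; exact ⟨rfl, fun _ _ => rfl⟩
    by_cases h0 : P = []
    · subst h0
      refine (hscalar hPL' c⁻¹ (inv_ne_zero hc) ?_).symm
      rw [eq_inv_smul_iff₀ hc, ← h]
      rfl
    by_cases h0' : P' = []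
    · subst h0'
      exact hscalar hPL c hc h
    rw [hop, hop] at h
    have h2 := hsep _ _ (by simpa using h0) (by simpa using h0') (hchain hP hPL)
      (hchain hP' hPL') c h
    -- A left inverse of `f` on `L`; the value `1` at the isolated vertex is never used.
    have hleft : ∀ {R : List (Op d)}, (∀ X ∈ R, X ∈ L) →
        (R.map f).map (fun a => a.elim 1 Subtype.val) = R := by
      intro R hR
      rw [List.map_map]
      exact (List.map_congr_left fun X hX => by simp [hf X (hR X hX)]).trans (List.map_id R)
    rw [← hleft hPL, h2, hleft hPL']

end Blocks

/-- The separating realisations are chosen independently for each party. Nonvanishing of all factors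
turns equality of the tensor products into proportionality party by party. -/
theorem EntriesEqualAtRank.blocksAgree {m : ℕ} {d : Fin m → ℕ} (hd : ∀ i, 0 < d i) {r s : ℕ}
    (hr : 1 ≤ r) (hs : 2 ≤ s) {P P' : ∀ i, List (Op (d i))} (hP : ∀ i, IsBlock r (P i))
    (hP' : ∀ i, IsBlock r (P' i)) (h : EntriesEqualAtRank s P P') : BlocksAgree P P' := by
  choose n φ hb hb' hco hor hone hne hne' hsep using fun i =>
    exists_separating_realisation (hd i) hr hs (hP i) (hP' i)
  have heq := eq_of_forall_state (h n φ ⟨hb, hb', hco, hor, hone⟩)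
  intro i
  obtain ⟨c, hc, hci⟩ := exists_smul_eq_of_tensorOp_eq hne heq i
  exact hsep i c hc hci

end MomentEntry

theorem mainTheorem3 (m : ℕ) (d : Fin m → ℕ) (hd : ∀ i, 0 < d i) (r : ℕ) (hr : 1 ≤ r)
    (P P' : ∀ i, List (MomentEntry.Op (d i)))
    (hP : ∀ i, MomentEntry.IsBlock r (P i)) (hP' : ∀ i, MomentEntry.IsBlock r (P' i)) :
    (MomentEntry.AlgebraicallyEqual P P' ↔ MomentEntry.BlocksAgree P P') ∧
    ((∀ s, 1 ≤ s → MomentEntry.EntriesEqualAtRank s P P') ↔ MomentEntry.BlocksAgree P P') ∧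
    (2 ≤ r → (MomentEntry.EntriesEqualAtRank r P P' ↔ MomentEntry.BlocksAgree P P')) := by
  have hne : ∀ i, ∀ X ∈ P i ++ P' i, X ≠ 0 := by
    intro i X hX
    rcases List.mem_append.mp hX with hX | hX
    · exact MomentEntry.ne_zero_of_rank hr ((hP i).rank_eq X hX)
    · exact MomentEntry.ne_zero_of_rank hr ((hP' i).rank_eq X hX)
  have hBA : MomentEntry.BlocksAgree P P' → MomentEntry.AlgebraicallyEqual P P' :=
    .of_blocksAgree (fun i => (hP i).projector) (fun i => (hP' i).projector)
  have hAE : MomentEntry.AlgebraicallyEqual P P' →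
      ∀ s, MomentEntry.EntriesEqualAtRank s P P' :=
    fun h s => h.entriesEqualAtRank hd hne
  have hEB : ∀ s, 2 ≤ s → MomentEntry.EntriesEqualAtRank s P P' →
      MomentEntry.BlocksAgree P P' :=
    fun s hs h => h.blocksAgree hd hr hs hP hP'
  -- Rank `2` is the smallest rank with separating realisations, and it serves for the first two
  -- claims whatever `r` is.
  exact ⟨⟨fun h => hEB 2 le_rfl (hAE h 2), hBA⟩,
    ⟨fun h => hEB 2 le_rfl (h 2 one_le_two), fun h s _ => hAE (hBA h) s⟩,
    fun h2 => ⟨hEB r h2, fun h => hAE (hBA h) r⟩⟩
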